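/- Let $n\ge 1$ be an integer and let $p>1$ be a real number. For a smooth, strictly convex body $K\subset\mathbb{R}^{n+1}$ (a compact convex set with non-empty interior whose boundary is a smoothly embedded hypersurface with Gauss map a diffeomorphism onto the unit sphere $\mathbb{S}^n$) let $s_K(z)=\max_{y\in K}\langle y,z\rangle$, $z\in\mathbb{S}^n$, be its support function, and let $$\mathcal{K}_K=\Bigl(\det\nolimits_{\bar g}\bigl[\bar\nabla_i\bar\nabla_j s_K+\bar g_{ij}s_K\bigr]\Bigr)^{-1}$$ be its Gauss curvature as a function of the outer unit normal $z\in\mathbb{S}^n$, where $\bar g$ and $\bar\nabla$ are the round metric of $\mathbb{S}^n$ and its Levi-Civita connection. A smooth solution of the $p$ centro-affine normal flow ($p$-flow) on $[0,T)$ is a family $\{K_t\}_{0\le t<T}$ of smooth, strictly convex bodies, symmetric about the origin, whose support functions $s(z,t)=s_{K_t}(z)$ form a smooth function on $\mathbb{S}^n\times[0,T)$ with $$\partial_t s=-s\left(\frac{\mathcal{K}}{s^{n+2}}\right)^{\frac{p}{p+n+1}}\qquad\text{on }\mathbb{S}^n\times[0,T),$$ where $\mathcal{K}(z,t)=\mathcal{K}_{K_t}(z)$.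 **Lemma (Harnack estimate).** Let $\{K_t\}_{0\le t<T}$ be a smooth solution of the $p$-flow. Then for each $z\in\mathbb{S}^n$ the function $$t\mapsto \left(s\left(\frac{\mathcal{K}}{s^{n+2}}\right)^{\frac{p}{p+n+1}}\right)(z,t)\; t^{\frac{np}{(p+1)(n+1)}}$$ is non-decreasing on $[0,T)$; moreover, for all $z\in\mathbb{S}^n$ and $0<t<T$ the time derivatives below exist and $$\partial_t\left(s\left(\frac{\mathcal{K}}{s^{n+2}}\right)^{\frac{p}{p+n+1}}t^{\frac{np}{(p+1)(n+1)}}\right)\ge 0,$$ or equivalently $$\partial_t\left(s\left(\frac{\mathcal{K}}{s^{n+2}}\right)^{\frac{p}{p+n+1}}\right)\ge-\frac{np}{(p+1)(n+1)\,t}\;s\left(\frac{\mathcal{K}}{s^{n+2}}\right)^{\frac{p}{p+n+1}}.$$ -/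

import Mathlib

open scoped Manifold ContDiff

noncomputable section

namespace CentroAffine

/-- The Euclidean space `ℝⁿ⁺¹`. -/
abbrev Space (n : ℕ) : Type := EuclideanSpace ℝ (Fin (n + 1))

/-- The unit sphere `𝕊ⁿ` of `ℝⁿ⁺¹`. -/
abbrev Sph (n : ℕ) : Type := Metric.sphere (0 : Space n) 1

/-- The tangent space of `𝕊ⁿ` at `z`, as the subspace `z^⊥` of `ℝⁿ⁺¹`. -/
abbrev tangentSpaceAt {n : ℕ} (z : Space n) : Submodule ℝ (Space n) := (ℝ ∙ z)ᗮ

/-- The support function `z ↦ max {⟨y, z⟩ : y ∈ K}` of a convex body. In the sequel it is only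
evaluated at unit vectors. -/
def supportFn {n : ℕ} (K : ConvexBody (Space n)) (z : Space n) : ℝ :=
  sSup ((fun y : Space n => inner ℝ y z) '' (K : Set (Space n)))

/-- The extension of a function on the unit sphere which is constant along rays from the origin.
It only depends on the restriction of `f` to the unit sphere. -/
def radialExt {n : ℕ} (f : Space n → ℝ) (x : Space n) : ℝ := f (‖x‖⁻¹ • x)

/-- The Hessian at `z ∈ 𝕊ⁿ` of (the restriction to `𝕊ⁿ` of) `f` with respect to the Levi-Civita
connection of the round metric, as a bilinear form; only its values on vectors orthogonal to `z`
matter. Since the extension of `f` that is constant along rays has zero derivative in the direction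
normal to the sphere, the second covariant derivative on the sphere is the restriction to tangent
vectors of the ordinary second derivative of this extension; compare
`deriv_deriv_geodesic_eq_sphereHess`. -/
def sphereHess {n : ℕ} (f : Space n → ℝ) (z : Space n) : Space n →L[ℝ] Space n →L[ℝ] ℝ :=
  fderiv ℝ (fun x => fderiv ℝ (radialExt f) x) z

/-- The form of the radii of curvature `𝔯 = ∇̄²s + s ḡ` at `z ∈ 𝕊ⁿ`, where `s` is the support
function of `K`. -/
def radiiForm {n : ℕ} (K : ConvexBody (Space n)) (z u v : Space n) : ℝ :=
  sphereHess (supportFn K) z u v + supportFn K z * inner ℝ u v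

/-- `Sₙ = det 𝔯 / det ḡ`: the determinant of `𝔯` in an orthonormal basis of the tangent space of
the sphere (it does not depend on the basis, see `detRadii_eq`). -/
def detRadii {n : ℕ} (K : ConvexBody (Space n)) (z : Space n) : ℝ :=
  (Matrix.of fun i j =>
    radiiForm K z (stdOrthonormalBasis ℝ (tangentSpaceAt z) i)
      (stdOrthonormalBasis ℝ (tangentSpaceAt z) j)).det

/-- The Gauss curvature of `∂K` as a function of the outer unit normal. -/
def gaussCurvature {n : ℕ} (K : ConvexBody (Space n)) (z : Space n) : ℝ := (detRadii K z)⁻¹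

/-- The speed `s (𝒦 / sⁿ⁺²)^(p / (p + n + 1))` of the `p` centro-affine normal flow, as a function
of the outer unit normal. -/
def speed {n : ℕ} (p : ℝ) (K : ConvexBody (Space n)) (z : Space n) : ℝ :=
  supportFn K z * (gaussCurvature K z / supportFn K z ^ (n + 2)) ^ (p / (p + n + 1))

/-- Smooth, strictly convex bodies: `K` has interior points, and its boundary is a smoothly embedded
hypersurface whose Gauss map is a diffeomorphism onto `𝕊ⁿ`. The latter is expressed through the
inverse `Y` of the Gauss map: `Y` is a smooth embedding (an injective immersion of a compact
manifold) of `𝕊ⁿ` onto `∂K`, and `z` is an outer unit normal of `K` at `Y z`. -/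
def IsSmoothStrictlyConvex {n : ℕ} (K : ConvexBody (Space n)) : Prop :=
  (interior (K : Set (Space n))).Nonempty ∧
  ∃ Y : Sph n → Space n,
    ContMDiff (𝓡 n) 𝓘(ℝ, Space n) ∞ Y ∧
    Function.Injective Y ∧
    (∀ z : Sph n, Function.Injective (mfderiv (𝓡 n) 𝓘(ℝ, Space n) Y z)) ∧
    Set.range Y = frontier (K : Set (Space n)) ∧
    ∀ z : Sph n, ∀ x ∈ K, inner ℝ x (z : Space n) ≤ inner ℝ (Y z) (z : Space n)

/-- The class of smooth, strictly convex bodies that are symmetric about the origin. -/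
def IsSymmSmoothStrictlyConvex {n : ℕ} (K : ConvexBody (Space n)) : Prop :=
  IsSmoothStrictlyConvex K ∧ ∀ x ∈ K, -x ∈ K

/-- `(K t)`, `0 ≤ t < T`, is a smooth solution of the `p` centro-affine normal flow
`∂ₜ s = - s (𝒦 / sⁿ⁺²)^(p / (p + n + 1))` in the class of smooth, strictly convex, origin-symmetric
bodies. (The values of `K` outside `[0, T)` play no role, and the time derivative at `t = 0` is
one-sided.) -/
structure IsPFlow {n : ℕ} (p T : ℝ) (K : ℝ → ConvexBody (Space n)) : Prop where
  body : ∀ t ∈ Set.Ico 0 T, IsSymmSmoothStrictlyConvex (K t)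
  smooth : ContMDiffOn ((𝓡 n).prod 𝓘(ℝ, ℝ)) 𝓘(ℝ, ℝ) ∞
    (fun q : Sph n × ℝ => supportFn (K q.2) (q.1 : Space n)) (Set.univ ×ˢ Set.Ico 0 T)
  evolution : ∀ t ∈ Set.Ico 0 T, ∀ z : Sph n,
    HasDerivWithinAt (fun τ => supportFn (K τ) (z : Space n))
      (-speed p (K t) (z : Space n)) (Set.Ico 0 T) t

/-- The Hessian on the sphere is the second derivative along great circles. -/
theorem deriv_deriv_geodesic_eq_sphereHess {n : ℕ} (f : Space n → ℝ) (z u : Space n)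
    (hz : ‖z‖ = 1) (hu : ‖u‖ = 1) (hzu : inner ℝ z u = 0)
    (hf : ContDiffAt ℝ 2 (radialExt f) z) :
    deriv (deriv fun τ : ℝ => f (Real.cos τ • z + Real.sin τ • u)) 0 = sphereHess f z u u := by
  obtain ⟨F, hF⟩ : ∃ F, F = radialExt f := ⟨_, rfl⟩
  rw [← hF] at hf
  set c : ℝ → Space n := fun τ => Real.cos τ • z + Real.sin τ • u with hc
  set c' : ℝ → Space n := fun τ => (-Real.sin τ) • z + Real.cos τ • u with hc'
  have hnorm : ∀ τ, ‖c τ‖ = 1 := by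
    intro τ
    have h1 : ‖c τ‖ ^ 2 = 1 := by
      rw [hc]
      simp only
      rw [norm_add_sq_real, norm_smul, norm_smul, inner_smul_left, inner_smul_right, hzu, hz, hu]
      simp
    nlinarith [norm_nonneg (c τ)]
  have hcf : (fun τ : ℝ => f (Real.cos τ • z + Real.sin τ • u)) = fun τ => F (c τ) := by
    funext τ
    have h1 : F (c τ) = f (‖c τ‖⁻¹ • c τ) := by rw [hF]; rfl
    rw [h1, hnorm τ, inv_one, one_smul]
  have hcd : ∀ τ, HasDerivAt c (c' τ) τ := fun τ =>
    ((Real.hasDerivAt_cos τ).smul_const z).add ((Real.hasDerivAt_sin τ).smul_const u)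
  have hcd' : HasDerivAt c' (-z) 0 := by
    have h1 : HasDerivAt c' ((-Real.cos 0) • z + (-Real.sin 0) • u) 0 :=
      ((Real.hasDerivAt_sin 0).neg.smul_const z).add ((Real.hasDerivAt_cos 0).smul_const u)
    simpa using h1
  have hc0 : c 0 = z := by simp [hc]
  have hc0' : c' 0 = u := by simp [hc']
  have hcont : Filter.Tendsto c (nhds 0) (nhds z) := by
    simpa [hc0] using (hcd 0).continuousAt.tendsto
  have hev : ∀ᶠ τ in nhds (0 : ℝ), DifferentiableAt ℝ F (c τ) :=
    hcont.eventually ((hf.eventually (by simp)).mono fun x hx => hx.differentiableAt (by simp))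
  have hd1 : deriv (fun τ => F (c τ)) =ᶠ[nhds 0] fun τ => fderiv ℝ F (c τ) (c' τ) := by
    filter_upwards [hev] with τ hτ
    exact (hτ.hasFDerivAt.comp_hasDerivAt τ (hcd τ)).deriv
  have hF1 : HasFDerivAt (fun x => fderiv ℝ F x) (sphereHess f z) (c 0) := by
    rw [hc0, sphereHess, ← hF]
    exact ((hf.fderiv_right (m := 1) (by norm_num)).differentiableAt (by simp)).hasFDerivAt
  have hradial : fderiv ℝ F z z = 0 := by
    have h1 : HasDerivAt (fun r : ℝ => F (r • z)) (fderiv ℝ F z z) 1 := by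
      have h2 : HasDerivAt (fun r : ℝ => r • z) z 1 := by
        simpa using (hasDerivAt_id (1 : ℝ)).smul_const z
      have h3 : HasFDerivAt F (fderiv ℝ F z) ((1 : ℝ) • z) := by
        rw [one_smul]
        exact (hf.differentiableAt (by simp)).hasFDerivAt
      exact h3.comp_hasDerivAt 1 h2
    have h4 : (fun r : ℝ => F (r • z)) =ᶠ[nhds 1] fun _ => F z := by
      filter_upwards [lt_mem_nhds (show (0 : ℝ) < 1 by norm_num)] with r hr
      simp only [hF, radialExt, norm_smul, hz, Real.norm_eq_abs, abs_of_pos hr, mul_one, smul_smul,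
        inv_mul_cancel₀ hr.ne', inv_one]
    exact h1.unique ((hasDerivAt_const (1 : ℝ) (F z)).congr_of_eventuallyEq h4)
  rw [hcf, hd1.deriv_eq]
  have h5 : HasDerivAt (fun τ => fderiv ℝ F (c τ) (c' τ))
      (sphereHess f z (c' 0) (c' 0) + fderiv ℝ F (c 0) (-z)) 0 :=
    (hF1.comp_hasDerivAt (0 : ℝ) (hcd 0)).clm_apply hcd'
  rw [h5.deriv, hc0, hc0', map_neg, hradial]
  simp

/-- `Sₙ` may be computed in any orthonormal basis of the tangent space. -/
theorem detRadii_eq {n : ℕ} {ι : Type*} [Fintype ι] [DecidableEq ι] (K : ConvexBody (Space n))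
    (z : Space n) (b : OrthonormalBasis ι ℝ (tangentSpaceAt z)) :
    detRadii K z = (Matrix.of fun i j => radiiForm K z (b i) (b j)).det := by
  let B : LinearMap.BilinForm ℝ (tangentSpaceAt z) :=
    LinearMap.mk₂ ℝ (fun u v => radiiForm K z u v)
      (fun u u' v => by simp [radiiForm, inner_add_left]; ring)
      (fun c u v => by simp [radiiForm, inner_smul_left]; ring)
      (fun u v v' => by simp [radiiForm, inner_add_right]; ring)
      (fun c u v => by simp [radiiForm, inner_smul_right]; ring)
  let e := stdOrthonormalBasis ℝ (tangentSpaceAt z)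
  let σ : ι ≃ Fin (Module.finrank ℝ (tangentSpaceAt z)) :=
    Fintype.equivFinOfCardEq (Module.finrank_eq_card_basis b.toBasis).symm
  let c := b.reindex σ
  have h1 : (Matrix.of fun i j => radiiForm K z (b i) (b j)).det =
      (LinearMap.BilinForm.toMatrix c.toBasis B).det := by
    rw [← Matrix.det_submatrix_equiv_self σ]
    congr 1
    ext i j
    simp [c, B, LinearMap.BilinForm.toMatrix_apply]
  have h2 : detRadii K z = (LinearMap.BilinForm.toMatrix e.toBasis B).det := by
    rw [detRadii]
    congr 1
    ext i j
    simp [e, B, LinearMap.BilinForm.toMatrix_apply]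
  rw [h1, h2, ← LinearMap.BilinForm.toMatrix_mul_basis_toMatrix e.toBasis c.toBasis B,
    Matrix.det_mul, Matrix.det_mul, Matrix.det_transpose]
  have h3 : (e.toBasis.toMatrix c.toBasis).det = 1 ∨ (e.toBasis.toMatrix c.toBasis).det = -1 := by
    have := e.det_to_matrix_orthonormalBasis_real c
    simpa [Module.Basis.det_apply] using this
  rcases h3 with h | h <;> rw [h] <;> ring

end CentroAffine

end

/-! Extend `s` to be homogeneous of degree one. Then `𝔯 = ∇̄²s + s ḡ` is the ordinary Hessian of `s`
restricted to `z^⊥`, and no covariant calculus is needed.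

Put `V = ∂ₜs = -speed < 0`, `Q = ∂ₜV / V`, `h = V / s < 0`, `a = p / (p + n + 1)` and `β = 1 - (n +
2) a`. Since `log |V| = β log s - a log det 𝔯`, differentiating once gives `Q = β h - a S` with `S =
tr (𝔯⁻¹ Hess V)` (`logSpeedDeriv_eq`). Differentiating again, with `∂ₜV = Q V`, gives `∂ₜQ = β (Q h
- h²) + a tr ((𝔯⁻¹ Hess V)²) - a tr (𝔯⁻¹ Hess (Q V))`.

At a spatial minimum of `Q` the last Hessian is `Q Hess V + V Hess Q`, and the second summand
contributes with a good sign because `V < 0`. Cauchy-Schwarz bounds the squared trace below by `S² /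
n`. As `p > 1` makes `β ≤ 0`, the terms in `h` help when `Q < 0`, leaving `Q² ≤ c ∂ₜQ` with `c = np
/ ((p + 1)(n + 1))` (`harnack_algebra`, `sq_le_of_isLocalMin`).

Comparison with the ODE solution `-c / t` by the maximum principle gives `t Q + c ≥ 0`
(`neg_le_mul_logSpeedDeriv`), which is the Harnack inequality. -/

/-! ### Matrix calculus and trace inequalities. -/

theorem hasDerivAt_matrix_det {ι : Type*} [Fintype ι] [DecidableEq ι] {M : ℝ → Matrix ι ι ℝ}
    {M' : Matrix ι ι ℝ} {t : ℝ} (h : ∀ i j, HasDerivAt (fun τ => M τ i j) (M' i j) t) :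
    HasDerivAt (fun τ => (M τ).det) ((M t).adjugate * M').trace t := by
  have h1 : HasDerivAt (fun τ => (M τ).det)
      (∑ σ : Equiv.Perm ι, (Equiv.Perm.sign σ : ℤ) •
        ∑ i, (∏ j ∈ Finset.univ.erase i, M t (σ j) j) • M' (σ i) i) t := by
    simp only [Matrix.det_apply, Units.smul_def]
    refine HasDerivAt.fun_sum fun σ _ => ?_
    simp only [zsmul_eq_mul]
    exact (HasDerivAt.fun_finsetProd fun i _ => h (σ i) i).const_mul _
  convert h1 using 1
  -- Cramer's rule: each diagonal entry is a determinant with one column differentiated, matching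
  -- the product rule in the Leibniz expansion.
  have h2 : ∀ i, ((M t).adjugate * M') i i = ((M t).updateCol i fun k => M' k i).det := by
    intro i
    rw [← Matrix.cramer_apply, Matrix.cramer_eq_adjugate_mulVec]
    rfl
  simp only [Matrix.trace, Matrix.diag_apply, h2, Matrix.det_apply, Units.smul_def,
    Finset.smul_sum]
  rw [Finset.sum_comm]
  refine Finset.sum_congr rfl fun σ _ => Finset.sum_congr rfl fun i _ => ?_
  congr 1
  rw [← Finset.mul_prod_erase _ _ (Finset.mem_univ i), mul_comm, smul_eq_mul]
  congr 1
  · refine Finset.prod_congr rfl fun j hj => ?_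
    rw [Matrix.updateCol_ne (Finset.ne_of_mem_erase hj)]
  · simp

theorem hasDerivAt_matrix_mul {ι : Type*} [Fintype ι] {M N : ℝ → Matrix ι ι ℝ}
    {M' N' : Matrix ι ι ℝ} {t : ℝ} (hM : ∀ i j, HasDerivAt (fun τ => M τ i j) (M' i j) t)
    (hN : ∀ i j, HasDerivAt (fun τ => N τ i j) (N' i j) t) (i j : ι) :
    HasDerivAt (fun τ => (M τ * N τ) i j) ((M' * N t + M t * N') i j) t := by
  simp only [Matrix.mul_apply, Matrix.add_apply, ← Finset.sum_add_distrib]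
  exact HasDerivAt.fun_sum fun k _ => (hM i k).mul (hN k j)

theorem hasDerivAt_matrix_inv {ι : Type*} [Fintype ι] [DecidableEq ι] {M : ℝ → Matrix ι ι ℝ}
    {M' : Matrix ι ι ℝ} {t : ℝ} (h : ∀ i j, HasDerivAt (fun τ => M τ i j) (M' i j) t)
    (h0 : (M t).det ≠ 0) (i j : ι) :
    HasDerivAt (fun τ => (M τ)⁻¹ i j) ((-((M t)⁻¹ * M' * (M t)⁻¹)) i j) t := by
  have hd := hasDerivAt_matrix_det h
  have hadj : ∀ i j, DifferentiableAt ℝ (fun τ => (M τ).adjugate i j) t := by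
    intro i j
    simp only [Matrix.adjugate_apply]
    refine (hasDerivAt_matrix_det (M := fun τ => (M τ).updateRow j (Pi.single i 1))
      (M' := M'.updateRow j 0) fun k l => ?_).differentiableAt
    by_cases hk : k = j
    · subst hk
      simpa using hasDerivAt_const t ((Pi.single i 1 : ι → ℝ) l)
    · simpa [Matrix.updateRow_ne hk] using h k l
  have hinv : ∀ i j, DifferentiableAt ℝ (fun τ => (M τ)⁻¹ i j) t := by
    intro i j
    simp only [Matrix.inv_def, Matrix.smul_apply, Ring.inverse_eq_inv', smul_eq_mul]
    exact (hd.differentiableAt.inv h0).mul (hadj i j)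
  set X : Matrix ι ι ℝ := Matrix.of fun i j => deriv (fun τ => (M τ)⁻¹ i j) t with hX
  have hXd : ∀ i j, HasDerivAt (fun τ => (M τ)⁻¹ i j) (X i j) t := fun i j =>
    (hinv i j).hasDerivAt
  have hu : IsUnit (M t).det := isUnit_iff_ne_zero.mpr h0
  -- Once the inverse is known to be differentiable, its derivative follows by differentiating `M⁻¹
  -- M = 1`.
  have key : X * M t + (M t)⁻¹ * M' = 0 := by
    ext i j
    refine (hasDerivAt_matrix_mul hXd h i j).unique ?_
    refine (hasDerivAt_const t ((1 : Matrix ι ι ℝ) i j)).congr_of_eventuallyEq ?_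
    filter_upwards [hd.continuousAt.eventually_ne h0] with τ hτ
    rw [Matrix.nonsing_inv_mul _ (isUnit_iff_ne_zero.mpr hτ)]
  have h3 : X = -((M t)⁻¹ * M' * (M t)⁻¹) := by
    have := congrArg (· * (M t)⁻¹) key
    simp only [add_mul, zero_mul, Matrix.mul_assoc, Matrix.mul_nonsing_inv _ hu, mul_one] at this
    rw [Matrix.mul_assoc]
    exact eq_neg_of_add_eq_zero_left this
  rw [← h3]
  exact hXd i j

/-- The derivative of `tr (M⁻¹ N)`. -/
theorem hasDerivAt_trace_inv_mul {ι : Type*} [Fintype ι] [DecidableEq ι]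
    {M N : ℝ → Matrix ι ι ℝ} {M' N' : Matrix ι ι ℝ} {t : ℝ}
    (hM : ∀ i j, HasDerivAt (fun τ => M τ i j) (M' i j) t)
    (hN : ∀ i j, HasDerivAt (fun τ => N τ i j) (N' i j) t) (h0 : (M t).det ≠ 0) :
    HasDerivAt (fun τ => ((M τ)⁻¹ * N τ).trace)
      (-((M t)⁻¹ * M' * ((M t)⁻¹ * N t)).trace + ((M t)⁻¹ * N').trace) t := by
  have h := hasDerivAt_matrix_mul (hasDerivAt_matrix_inv hM h0) hN
  have h2 : HasDerivAt (fun τ => ((M τ)⁻¹ * N τ).trace)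
      ((-((M t)⁻¹ * M' * (M t)⁻¹) * N t + (M t)⁻¹ * N').trace) t :=
    HasDerivAt.fun_sum fun i _ => h i i
  convert h2 using 1
  simp [Matrix.mul_assoc]

theorem hasDerivAt_log_det {ι : Type*} [Fintype ι] [DecidableEq ι] {M : ℝ → Matrix ι ι ℝ}
    {M' : Matrix ι ι ℝ} {t : ℝ} (h : ∀ i j, HasDerivAt (fun τ => M τ i j) (M' i j) t)
    (h0 : (M t).det ≠ 0) :
    HasDerivAt (fun τ => Real.log (M τ).det) ((M t)⁻¹ * M').trace t := by
  convert (hasDerivAt_matrix_det h).log h0 using 1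
  rw [Matrix.inv_def, Ring.inverse_eq_inv', Matrix.smul_mul, Matrix.trace_smul, smul_eq_mul,
    div_eq_inv_mul]

open scoped MatrixOrder in
theorem Matrix.PosDef.exists_inv_eq_mul_transpose {ι : Type*} [Fintype ι] [DecidableEq ι]
    {M : Matrix ι ι ℝ} (hM : M.PosDef) : ∃ C : Matrix ι ι ℝ, M⁻¹ = C * C.transpose := by
  obtain ⟨B, hB⟩ := (CStarAlgebra.nonneg_iff_eq_star_mul_self (a := M⁻¹)).mp
    hM.inv.posSemidef.nonneg
  exact ⟨B.transpose, by simpa [Matrix.star_eq_conjTranspose] using hB⟩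

/-- With `M⁻¹ = C Cᵀ` the trace is that of `Cᵀ B C`, whose diagonal entries are the values of the
quadratic form of `B` at the columns of `C`. -/
theorem Matrix.PosDef.trace_inv_mul_nonneg {ι : Type*} [Fintype ι] [DecidableEq ι]
    {M B : Matrix ι ι ℝ} (hM : M.PosDef) (hB : ∀ v : ι → ℝ, 0 ≤ v ⬝ᵥ B.mulVec v) :
    0 ≤ (M⁻¹ * B).trace := by
  obtain ⟨C, hC⟩ := hM.exists_inv_eq_mul_transpose
  rw [hC, Matrix.mul_assoc, Matrix.trace_mul_comm, Matrix.mul_assoc]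
  refine Finset.sum_nonneg fun i _ => ?_
  exact hB fun k => C k i

/-- Both traces are those of the symmetric matrix `N = Cᵀ A C` and its square. Apply Cauchy-Schwarz
to the diagonal of `N`, then add the off-diagonal squares. -/
theorem Matrix.PosDef.sq_trace_inv_mul_le {ι : Type*} [Fintype ι] [DecidableEq ι]
    {M A : Matrix ι ι ℝ} (hM : M.PosDef) (hA : A.transpose = A) :
    (M⁻¹ * A).trace ^ 2 ≤ Fintype.card ι * (M⁻¹ * A * (M⁻¹ * A)).trace := by
  obtain ⟨C, hC⟩ := hM.exists_inv_eq_mul_transpose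
  set N := C.transpose * A * C with hN
  have hNt : N.transpose = N := by simp [hN, hA, Matrix.mul_assoc]
  have h1 : (M⁻¹ * A).trace = N.trace := by
    rw [hC, hN, Matrix.mul_assoc, Matrix.trace_mul_comm]
  have h2 : (M⁻¹ * A * (M⁻¹ * A)).trace = (N * N).trace := by
    rw [hC, hN, Matrix.mul_assoc, Matrix.mul_assoc, Matrix.trace_mul_comm]
    simp only [Matrix.mul_assoc]
  rw [h1, h2]
  have h3 : N.trace ^ 2 ≤ Fintype.card ι * ∑ i, N i i ^ 2 := by
    simpa [Matrix.trace] using sq_sum_le_card_mul_sum_sq (s := Finset.univ) (f := fun i => N i i)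
  refine h3.trans (mul_le_mul_of_nonneg_left ?_ (by positivity))
  refine Finset.sum_le_sum fun i _ => ?_
  rw [Matrix.diag_apply, Matrix.mul_apply]
  have h4 : ∀ k, N i k * N k i = N i k ^ 2 := fun k => by
    rw [sq]; congr 1; exact congrFun (congrFun hNt i) k
  simp only [h4]
  exact Finset.single_le_sum (f := fun k => N i k ^ 2) (fun k _ => sq_nonneg _)
    (Finset.mem_univ i)

/-! ### Directional derivatives. -/

namespace CentroAffine

section DirDeriv

variable {F : Type*} [NormedAddCommGroup F] [NormedSpace ℝ F]

/-- The derivative of `f` in the direction `v`. -/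
noncomputable def dirDeriv (f : F → ℝ) (v q : F) : ℝ := fderiv ℝ f q v

variable {f g : F → ℝ} {Ω : Set F} {q u v w : F}

theorem contDiffAt_fderiv_of_contDiffOn (hf : ContDiffOn ℝ ∞ f Ω) (hΩ : IsOpen Ω) (hq : q ∈ Ω) :
    ContDiffAt ℝ ∞ (fderiv ℝ f) q :=
  (hf.contDiffAt (hΩ.mem_nhds hq)).fderiv_right (by simp)

theorem contDiffOn_dirDeriv (hf : ContDiffOn ℝ ∞ f Ω) (hΩ : IsOpen Ω) (v : F) :
    ContDiffOn ℝ ∞ (dirDeriv f v) Ω := fun _ hq =>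
  ((contDiffAt_fderiv_of_contDiffOn hf hΩ hq).clm_apply contDiffAt_const).contDiffWithinAt

theorem differentiableAt_of_contDiffOn (hf : ContDiffOn ℝ ∞ f Ω) (hΩ : IsOpen Ω) (hq : q ∈ Ω) :
    DifferentiableAt ℝ f q :=
  (hf.contDiffAt (hΩ.mem_nhds hq)).differentiableAt (by simp)

theorem dirDeriv_dirDeriv (hf : ContDiffOn ℝ ∞ f Ω) (hΩ : IsOpen Ω) (hq : q ∈ Ω) (v w : F) :
    dirDeriv (dirDeriv f v) w q = fderiv ℝ (fderiv ℝ f) q w v := by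
  have h := ((contDiffAt_fderiv_of_contDiffOn hf hΩ hq).differentiableAt (by simp)).hasFDerivAt
  have h2 : HasFDerivAt (dirDeriv f v)
      ((fderiv ℝ (fderiv ℝ f) q).flip v) q := by
    have := h.clm_apply (hasFDerivAt_const v q)
    rwa [ContinuousLinearMap.comp_zero, zero_add] at this
  rw [dirDeriv, h2.fderiv]
  rfl

theorem dirDeriv_comm (hf : ContDiffOn ℝ ∞ f Ω) (hΩ : IsOpen Ω) (hq : q ∈ Ω) (v w : F) :
    dirDeriv (dirDeriv f v) w q = dirDeriv (dirDeriv f w) v q := by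
  rw [dirDeriv_dirDeriv hf hΩ hq, dirDeriv_dirDeriv hf hΩ hq]
  exact ((hf.contDiffAt (hΩ.mem_nhds hq)).isSymmSndFDerivAt
    (by simpa using ENat.LEInfty.out)) w v

theorem dirDeriv_congr (hΩ : IsOpen Ω) (hq : q ∈ Ω) (h : Set.EqOn f g Ω) (v : F) :
    dirDeriv f v q = dirDeriv g v q := by
  rw [dirDeriv, dirDeriv, (h.eventuallyEq_of_mem (hΩ.mem_nhds hq)).fderiv_eq]

theorem dirDeriv_neg (f : F → ℝ) (v q : F) :
    dirDeriv (fun q => -f q) v q = -dirDeriv f v q := by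
  simp [dirDeriv, fderiv_fun_neg]

theorem dirDeriv_mul (hf : DifferentiableAt ℝ f q) (hg : DifferentiableAt ℝ g q) (v : F) :
    dirDeriv (fun q => f q * g q) v q = f q * dirDeriv g v q + dirDeriv f v q * g q := by
  simp [dirDeriv, fderiv_fun_mul hf hg, mul_comm]

theorem dirDeriv_dirDeriv_mul (hf : ContDiffOn ℝ ∞ f Ω) (hg : ContDiffOn ℝ ∞ g Ω)
    (hΩ : IsOpen Ω) (hq : q ∈ Ω) (v w : F) :
    dirDeriv (dirDeriv (fun q => f q * g q) v) w q =
      f q * dirDeriv (dirDeriv g v) w q + dirDeriv f w q * dirDeriv g v q +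
        dirDeriv f v q * dirDeriv g w q + dirDeriv (dirDeriv f v) w q * g q := by
  have d := fun {k : F → ℝ} (hk : ContDiffOn ℝ ∞ k Ω) => differentiableAt_of_contDiffOn hk hΩ hq
  have hf' := contDiffOn_dirDeriv hf hΩ v
  have hg' := contDiffOn_dirDeriv hg hΩ v
  have h1 : Set.EqOn (dirDeriv (fun q => f q * g q) v)
      (fun q => f q * dirDeriv g v q + dirDeriv f v q * g q) Ω := fun x hx =>
    dirDeriv_mul (differentiableAt_of_contDiffOn hf hΩ hx)
      (differentiableAt_of_contDiffOn hg hΩ hx) v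
  rw [dirDeriv_congr hΩ hq h1, dirDeriv,
    fderiv_fun_add ((d hf).fun_mul (d hg')) ((d hf').fun_mul (d hg))]
  have h2 := dirDeriv_mul (d hf) (d hg') w
  have h3 := dirDeriv_mul (d hf') (d hg) w
  simp only [dirDeriv] at h2 h3 ⊢
  rw [add_apply, h2, h3]
  ring

theorem hasDerivAt_line (hf : DifferentiableAt ℝ f (q + (0 : ℝ) • v)) :
    HasDerivAt (fun τ : ℝ => f (q + τ • v)) (dirDeriv f v q) 0 := by
  have h1 : HasDerivAt (fun τ : ℝ => q + τ • v) v 0 := by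
    simpa using ((hasDerivAt_id (0 : ℝ)).smul_const v).const_add q
  have := hf.hasFDerivAt.comp_hasDerivAt (0 : ℝ) h1
  rwa [zero_smul, add_zero] at this

theorem deriv_line (hf : DifferentiableAt ℝ f q) :
    deriv (fun τ : ℝ => f (q + τ • v)) 0 = dirDeriv f v q :=
  (hasDerivAt_line (by simpa using hf)).deriv

/-- At a minimum along a line the first derivative vanishes and the second is non-negative. -/
theorem dirDeriv_of_isLocalMin_line (hf : ContDiffOn ℝ ∞ f Ω) (hΩ : IsOpen Ω) (hq : q ∈ Ω)
    (hmin : IsLocalMin (fun τ : ℝ => f (q + τ • v)) 0) :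
    dirDeriv f v q = 0 ∧ 0 ≤ dirDeriv (dirDeriv f v) v q := by
  have hd0 := deriv_line (v := v) (differentiableAt_of_contDiffOn hf hΩ hq)
  have h1 : dirDeriv f v q = 0 := by rw [← hd0]; exact hmin.deriv_eq_zero
  refine ⟨h1, ?_⟩
  have hc : Filter.Tendsto (fun τ : ℝ => q + τ • v) (nhds 0) (nhds q) := by
    have : Continuous (fun τ : ℝ => q + τ • v) := by fun_prop
    simpa using this.tendsto 0
  have hd : deriv (fun τ : ℝ => f (q + τ • v)) =ᶠ[nhds 0]
      fun τ => dirDeriv f v (q + τ • v) := by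
    filter_upwards [hc.eventually (hΩ.mem_nhds hq)] with τ hτ
    have h2 : HasDerivAt (fun τ : ℝ => q + τ • v) v τ := by
      simpa using ((hasDerivAt_id τ).smul_const v).const_add q
    exact ((differentiableAt_of_contDiffOn hf hΩ hτ).hasFDerivAt.comp_hasDerivAt τ h2).deriv
  have hdd : deriv (deriv fun τ : ℝ => f (q + τ • v)) 0 = dirDeriv (dirDeriv f v) v q := by
    rw [hd.deriv_eq]
    exact deriv_line (differentiableAt_of_contDiffOn (contDiffOn_dirDeriv hf hΩ v) hΩ hq)
  -- A negative second derivative would make the point a local maximum too, so the function would be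
  -- locally constant along the line.
  by_contra! hneg
  rw [← hdd] at hneg
  have hmax : IsLocalMax (fun τ : ℝ => f (q + τ • v)) 0 :=
    isLocalMax_of_deriv_deriv_neg hneg (hd0.trans h1)
      (hasDerivAt_line (by simpa using differentiableAt_of_contDiffOn hf hΩ hq)).continuousAt
  have hconst : (fun τ : ℝ => f (q + τ • v)) =ᶠ[nhds 0] fun _ => f (q + (0 : ℝ) • v) := by
    filter_upwards [hmin, hmax] with τ h2 h3 using le_antisymm h3 h2
  have h4 : deriv (fun τ : ℝ => f (q + τ • v)) =ᶠ[nhds 0] fun _ => 0 := by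
    filter_upwards [hconst.eventuallyEq_nhds] with τ hτ
    rw [hτ.deriv_eq]; simp
  rw [h4.deriv_eq] at hneg
  simp at hneg

end DirDeriv

section Slice

variable {E : Type*} [NormedAddCommGroup E] [NormedSpace ℝ E] {f : E × ℝ → ℝ} {x : E} {t : ℝ}

theorem hasDerivAt_time (hf : DifferentiableAt ℝ f (x, t)) :
    HasDerivAt (fun τ => f (x, τ)) (dirDeriv f (0, 1) (x, t)) t :=
  hf.hasFDerivAt.comp_hasDerivAt t ((hasDerivAt_const t x).prodMk (hasDerivAt_id t))

theorem dirDeriv_slice (hf : DifferentiableAt ℝ f (x, t)) (v : E) :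
    dirDeriv (fun y => f (y, t)) v x = dirDeriv f (v, 0) (x, t) := by
  have h1 : HasFDerivAt (fun y : E => (y, t)) ((ContinuousLinearMap.id ℝ E).prod 0) x :=
    (hasFDerivAt_id x).prodMk (hasFDerivAt_const t x)
  have h : HasFDerivAt (fun y => f (y, t)) _ x := hf.hasFDerivAt.comp x h1
  rw [dirDeriv, h.fderiv]
  rfl

end Slice

end CentroAffine

/-! ### Support functions and positivity of the radii of curvature. -/

namespace CentroAffine

variable {n : ℕ}

theorem bddAbove_inner_image (K : ConvexBody (Space n)) (x : Space n) :
    BddAbove ((fun y : Space n => inner ℝ y x) '' (K : Set (Space n))) :=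
  (K.isCompact.image (by fun_prop)).bddAbove

theorem inner_le_supportFn {K : ConvexBody (Space n)} {y : Space n} (hy : y ∈ K) (x : Space n) :
    inner ℝ y x ≤ supportFn K x :=
  le_csSup (bddAbove_inner_image K x) ⟨y, hy, rfl⟩

open scoped Pointwise in
theorem supportFn_smul (K : ConvexBody (Space n)) {c : ℝ} (hc : 0 ≤ c) (x : Space n) :
    supportFn K (c • x) = c * supportFn K x := by
  have h : (fun y : Space n => inner ℝ y (c • x)) '' (K : Set (Space n)) =
      c • ((fun y : Space n => inner ℝ y x) '' (K : Set (Space n))) := by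
    rw [← Set.image_smul, Set.image_image]
    simp [inner_smul_right]
  rw [supportFn, h, Real.sSup_smul_of_nonneg hc, smul_eq_mul, supportFn]

theorem radialExt_supportFn (K : ConvexBody (Space n)) :
    radialExt (supportFn K) = fun x => ‖x‖⁻¹ * supportFn K x := by
  funext x
  exact supportFn_smul K (by positivity) x

theorem supportFn_eq_norm_mul (K : ConvexBody (Space n)) {x : Space n} (hx : x ≠ 0) :
    supportFn K x = ‖x‖ * supportFn K (‖x‖⁻¹ • x) := by
  rw [supportFn_smul K (by positivity), mul_inv_cancel_left₀ (norm_ne_zero_iff.mpr hx)]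

/-- For `y` interior, both `y + δ x` and, by symmetry, `-y` lie in `K`; adding their two support
inequalities cancels `y`. -/
theorem supportFn_pos {K : ConvexBody (Space n)} (hK : IsSymmSmoothStrictlyConvex K)
    {x : Space n} (hx : x ≠ 0) : 0 < supportFn K x := by
  obtain ⟨⟨⟨y, hy⟩, -⟩, hs⟩ := hK
  obtain ⟨ε, hε, hb⟩ := Metric.isOpen_iff.mp isOpen_interior y hy
  have hxn : 0 < ‖x‖ := norm_pos_iff.mpr hx
  have h1 : y + (ε / 2 / ‖x‖) • x ∈ K := by
    refine interior_subset (hb ?_)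
    rw [Metric.mem_ball, dist_eq_norm, add_sub_cancel_left, norm_smul, Real.norm_eq_abs,
      abs_of_pos (by positivity), div_mul_cancel₀ _ hxn.ne']
    linarith
  have h2 := inner_le_supportFn h1 x
  have h3 := inner_le_supportFn (hs y (interior_subset hy)) x
  rw [inner_add_left, real_inner_smul_left, real_inner_self_eq_norm_sq] at h2
  rw [inner_neg_left] at h3
  have h4 : 0 < ε / 2 / ‖x‖ * ‖x‖ ^ 2 := by positivity
  linarith

theorem dirDeriv_inv_norm {E : Type*} [NormedAddCommGroup E] [InnerProductSpace ℝ E] {x : E}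
    (hx : x ≠ 0) (v : E) :
    dirDeriv (fun y : E => ‖y‖⁻¹) v x = -(‖x‖⁻¹ ^ 3 * inner ℝ x v) := by
  have h1 : HasFDerivAt (fun y : E => ‖y‖) (‖x‖⁻¹ • innerSL ℝ x) x := by
    have h2 := (hasStrictFDerivAt_norm_sq x).hasFDerivAt.sqrt (by simpa using hx)
    simp only [Real.sqrt_sq (norm_nonneg _)] at h2
    convert h2 using 1
    ext w
    simp
    ring
  have hn : ‖x‖ ≠ 0 := norm_ne_zero_iff.mpr hx
  have h3 := (hasDerivAt_inv hn).comp_hasFDerivAt x h1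
  have h4 : HasFDerivAt (fun y : E => ‖y‖⁻¹) _ x := h3
  rw [dirDeriv, h4.fderiv]
  simp
  field_simp

theorem contDiffOn_inv_norm {E : Type*} [NormedAddCommGroup E] [InnerProductSpace ℝ E] :
    ContDiffOn ℝ ∞ (fun y : E => ‖y‖⁻¹) {0}ᶜ := fun _ hx =>
  ((contDiffAt_norm ℝ hx).inv (norm_ne_zero_iff.mpr hx)).contDiffWithinAt

theorem dirDeriv_dirDeriv_inv_norm {E : Type*} [NormedAddCommGroup E] [InnerProductSpace ℝ E]
    {z u v : E} (hz : ‖z‖ = 1) (hv : inner ℝ z v = 0) :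
    dirDeriv (dirDeriv (fun y : E => ‖y‖⁻¹) v) u z = -inner ℝ u v := by
  have hz0 : z ∈ ({0}ᶜ : Set E) := by
    rintro rfl
    simp at hz
  have h1 : Set.EqOn (dirDeriv (fun y : E => ‖y‖⁻¹) v)
      (fun x => -(‖x‖⁻¹ ^ 3 * inner ℝ x v)) {0}ᶜ := fun x hx => dirDeriv_inv_norm hx v
  have hd1 : DifferentiableAt ℝ (fun x : E => ‖x‖⁻¹ ^ 3) z :=
    (differentiableAt_of_contDiffOn contDiffOn_inv_norm isOpen_compl_singleton hz0).pow 3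
  have hd2 : HasFDerivAt (fun x : E => inner ℝ x v) (innerSL ℝ v) z := by
    simpa [real_inner_comm] using (innerSL ℝ v).hasFDerivAt (x := z)
  rw [dirDeriv_congr isOpen_compl_singleton hz0 h1, dirDeriv_neg,
    dirDeriv_mul hd1 hd2.differentiableAt, hv, dirDeriv, hd2.fderiv]
  simp [hz, real_inner_comm]

/-- The radii form is the second derivative of the support function on tangent vectors. -/
theorem radiiForm_eq {K : ConvexBody (Space n)} (hK : ContDiffOn ℝ ∞ (supportFn K) {0}ᶜ)
    {z u v : Space n} (hz : ‖z‖ = 1) (hu : inner ℝ z u = 0) (hv : inner ℝ z v = 0) :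
    radiiForm K z u v = dirDeriv (dirDeriv (supportFn K) v) u z := by
  have hz0 : z ∈ ({0}ᶜ : Set (Space n)) := by
    rintro rfl
    simp at hz
  have hr : ContDiffOn ℝ ∞ (radialExt (supportFn K)) {0}ᶜ := by
    rw [radialExt_supportFn]
    exact contDiffOn_inv_norm.mul hK
  have h1 : sphereHess (supportFn K) z u v =
      dirDeriv (dirDeriv (radialExt (supportFn K)) v) u z :=
    (dirDeriv_dirDeriv hr isOpen_compl_singleton hz0 v u).symm
  -- On tangent vectors at `z` the first derivatives of `‖x‖⁻¹` vanish and its second derivative is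
  -- `-⟨u, v⟩`, which cancels the term `s ḡ`.
  rw [radiiForm, h1, radialExt_supportFn,
    dirDeriv_dirDeriv_mul contDiffOn_inv_norm hK isOpen_compl_singleton hz0,
    dirDeriv_dirDeriv_inv_norm hz hv, dirDeriv_inv_norm hz0, dirDeriv_inv_norm hz0, hu, hv, hz]
  ring

/-- The gradient of the support function inverts the Gauss map. -/
theorem inner_eq_dirDeriv_supportFn {K : ConvexBody (Space n)}
    (hK : ContDiffOn ℝ ∞ (supportFn K) {0}ᶜ) {z y : Space n} (hz : z ≠ 0) (hy : y ∈ K)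
    (hyz : ∀ x ∈ K, inner ℝ x z ≤ inner ℝ y z) (v : Space n) :
    inner ℝ y v = dirDeriv (supportFn K) v z ∧ 0 ≤ dirDeriv (dirDeriv (supportFn K) v) v z := by
  have hval : supportFn K z = inner ℝ y z := by
    refine le_antisymm (csSup_le ⟨_, y, hy, rfl⟩ ?_) (inner_le_supportFn hy z)
    rintro _ ⟨x, hx, rfl⟩
    exact hyz x hx
  have hlin : ContDiffOn ℝ ∞ (fun x : Space n => -inner ℝ y x) {0}ᶜ :=
    (contDiff_const.inner ℝ contDiff_id).neg.contDiffOn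
  have hdl : ∀ x w, dirDeriv (fun x : Space n => -inner ℝ y x) w x = -inner ℝ y w := fun x w => by
    rw [dirDeriv_neg, dirDeriv]
    have : HasFDerivAt (fun x : Space n => inner ℝ y x) (innerSL ℝ y) x :=
      (innerSL ℝ y).hasFDerivAt
    rw [this.fderiv]
    rfl
  -- The function `s - ⟨y, ·⟩` is non-negative and vanishes at `z`.
  have hmin : IsLocalMin (fun τ : ℝ => supportFn K (z + τ • v) + -inner ℝ y (z + τ • v)) 0 := by
    refine Filter.Eventually.of_forall fun τ => ?_
    have := inner_le_supportFn hy (z + τ • v)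
    simp only [zero_smul, add_zero, hval]
    linarith
  have hz0 : z ∈ ({0}ᶜ : Set (Space n)) := hz
  have h := dirDeriv_of_isLocalMin_line (f := fun x => supportFn K x + -inner ℝ y x)
    (hK.add hlin) isOpen_compl_singleton hz0 hmin
  have hsum : ∀ x ∈ ({0}ᶜ : Set (Space n)),
      dirDeriv (fun x => supportFn K x + -inner ℝ y x) v x =
        dirDeriv (supportFn K) v x + -inner ℝ y v := fun x hx => by
    rw [← hdl x v, dirDeriv, fderiv_fun_add
      (differentiableAt_of_contDiffOn hK isOpen_compl_singleton hx)
      (differentiableAt_of_contDiffOn hlin isOpen_compl_singleton hx)]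
    rfl
  refine ⟨by linarith [h.1, hsum z hz0], ?_⟩
  have h2 := h.2
  rw [dirDeriv_congr isOpen_compl_singleton hz0 hsum, dirDeriv, fderiv_add_const] at h2
  exact h2

/-- The Hessian `D` of `s` is semidefinite, so `D u u = 0` forces `D u = 0`. But the inverse Gauss
map `Y` is the gradient of `s` on the sphere, so its differential would kill the tangent vector `u`,
contradicting that `Y` is an immersion. -/
theorem radii_pos {K : ConvexBody (Space n)} (hs : IsSmoothStrictlyConvex K)
    (hK : ContDiffOn ℝ ∞ (supportFn K) {0}ᶜ) {z u : Space n} (hz : ‖z‖ = 1)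
    (hu : inner ℝ z u = 0) (hu0 : u ≠ 0) :
    0 < dirDeriv (dirDeriv (supportFn K) u) u z := by
  obtain ⟨-, Y, hYs, -, hinj, hrange, hY⟩ := hs
  have hz0 : z ∈ ({0}ᶜ : Set (Space n)) := by
    rintro rfl
    simp at hz
  let ζ : Sph n := ⟨z, by simpa using hz⟩
  have hmem : ∀ z : Sph n, Y z ∈ K := fun z =>
    K.isClosed.frontier_subset (hrange ▸ Set.mem_range_self z)
  have hne : ∀ z : Sph n, (z : Space n) ≠ 0 := fun z => ne_zero_of_mem_unit_sphere z
  have key := fun z : Sph n => inner_eq_dirDeriv_supportFn hK (hne z) (hmem z) (hY z)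
  refine lt_of_le_of_ne (key ζ u).2 fun h0 => hu0 ?_
  set D := fderiv ℝ (fderiv ℝ (supportFn K)) z
  have hDd : ∀ v w, dirDeriv (dirDeriv (supportFn K) v) w z = D w v := fun v w =>
    dirDeriv_dirDeriv hK isOpen_compl_singleton hz0 v w
  have hDsymm : ∀ v w, D w v = D v w := fun v w => by
    rw [← hDd, ← hDd, dirDeriv_comm hK isOpen_compl_singleton hz0]
  have hDu : D u = 0 := by
    ext w
    have hq : ∀ c : ℝ, 0 ≤ 2 * c * D u w + c * c * D w w := fun c => by
      have h1 := (key ζ (u + c • w)).2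
      have h2 : D u u = 0 := by rw [← hDd, ← h0]
      change 0 ≤ dirDeriv _ _ z at h1
      rw [hDd] at h1
      simp only [map_add, map_smul, add_apply, smul_apply, smul_eq_mul, h2, hDsymm u w] at h1
      linarith
    have hww : 0 ≤ D w w := by rw [← hDd]; exact (key ζ w).2
    by_contra hne
    change D u w ≠ 0 at hne
    -- A nearly minimizing `c`; the `+ 1` keeps the denominator positive when `D w w = 0`.
    have h3 := hq (-(D u w) / (D w w + 1))
    have h4 : 2 * (-(D u w) / (D w w + 1)) * D u w +
        -(D u w) / (D w w + 1) * (-(D u w) / (D w w + 1)) * D w w =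
        -((D u w) ^ 2 * (D w w + 2) / (D w w + 1) ^ 2) := by
      field_simp
      ring
    rw [h4] at h3
    have h5 : 0 < (D u w) ^ 2 * (D w w + 2) / (D w w + 1) ^ 2 := by positivity
    linarith
  have hmem_range : u ∈ (ℝ ∙ z)ᗮ := Submodule.mem_orthogonal_singleton_iff_inner_right.mpr hu
  have : Fact (Module.finrank ℝ (Space n) = n + 1) := ⟨finrank_euclideanSpace_fin⟩
  rw [← range_mvfderiv_subtypeVal (n := n) ζ] at hmem_range
  obtain ⟨w, hw⟩ := hmem_range
  suffices h : w = 0 by rw [← hw, h]; exact map_zero _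
  refine hinj ζ ?_
  rw [map_zero]
  have hYd : MDifferentiableAt (𝓡 n) 𝓘(ℝ, Space n) Y ζ := (hYs ζ).mdifferentiableAt (by simp)
  have hcd : MDifferentiableAt (𝓡 n) 𝓘(ℝ, Space n) ((↑) : Sph n → Space n) ζ :=
    (contMDiff_coe_sphere ζ).mdifferentiableAt one_ne_zero
  refine ext_inner_left (E := Space n) ℝ fun v => ?_
  have hcomp : (innerSL ℝ v) ∘ Y = dirDeriv (supportFn K) v ∘ ((↑) : Sph n → Space n) := by
    funext x
    rw [Function.comp_apply, Function.comp_apply, ← (key x v).1, innerSL_apply_apply,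
      real_inner_comm]
  have hgd : DifferentiableAt ℝ (dirDeriv (supportFn K) v) (ζ : Space n) :=
    differentiableAt_of_contDiffOn (contDiffOn_dirDeriv hK isOpen_compl_singleton v)
      isOpen_compl_singleton hz0
  have h1 := mfderiv_comp ζ (innerSL ℝ v).mdifferentiableAt hYd
  have h2 := mfderiv_comp ζ hgd.mdifferentiableAt hcd
  rw [hcomp, h2] at h1
  have h3 := DFunLike.congr_fun h1 w
  simp only [mfderiv_eq_fderiv, ContinuousLinearMap.fderiv] at h3
  have h4 : fderiv ℝ (dirDeriv (supportFn K) v) z u = 0 := by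
    change dirDeriv _ _ _ = 0
    rw [hDd, hDu]
    rfl
  rw [← hw] at h4
  exact (h3.symm.trans h4).trans (inner_zero_right (𝕜 := ℝ) (v : Space n)).symm

end CentroAffine

/-! ### The flow as a homogeneous function on space-time. -/

namespace CentroAffine

/-- The set of `(x, t)` with `x ≠ 0` and `0 < t < T`. -/
def flowDom (n : ℕ) (T : ℝ) : Set (Space n × ℝ) := {0}ᶜ ×ˢ Set.Ioo 0 T

/-- The support functions of a family of bodies as one function on space-time. -/
noncomputable def flowSupp {n : ℕ} (K : ℝ → ConvexBody (Space n)) (q : Space n × ℝ) : ℝ :=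
  supportFn (K q.2) q.1

variable {n : ℕ} {p T : ℝ} {K : ℝ → ConvexBody (Space n)}

theorem isOpen_flowDom : IsOpen (flowDom n T) := isOpen_compl_singleton.prod isOpen_Ioo

/-- Compose the smooth function on `𝕊ⁿ × [0, T)` with `(x, t) ↦ (x / ‖x‖, t)` and multiply by `‖x‖`.
Time `0` is left out so that the domain is open. -/
theorem contDiffOn_flowSupp (hK : IsPFlow p T K) : ContDiffOn ℝ ∞ (flowSupp K) (flowDom n T) := by
  let U : TopologicalSpace.Opens (Space n × ℝ) := ⟨flowDom n T, isOpen_flowDom⟩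
  have : Fact (Module.finrank ℝ (Space n) = n + 1) := ⟨finrank_euclideanSpace_fin⟩
  have hnorm : ContDiffOn ℝ ∞ (fun q : Space n × ℝ => ‖q.1‖) (flowDom n T) := fun q hq =>
    ((contDiffAt_norm ℝ hq.1).comp q contDiffAt_fst).contDiffWithinAt
  have hne : ∀ q ∈ flowDom n T, ‖q.1‖ ≠ 0 := fun q hq => norm_ne_zero_iff.mpr hq.1
  have hproj : ContDiffOn ℝ ∞ (fun q : Space n × ℝ => ‖q.1‖⁻¹ • q.1) (flowDom n T) :=
    (hnorm.inv hne).smul contDiffOn_fst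
  have h1 : ContMDiff 𝓘(ℝ, Space n × ℝ) 𝓘(ℝ, Space n) ∞
      (fun q : U => ‖(q : Space n × ℝ).1‖⁻¹ • (q : Space n × ℝ).1) := fun q =>
    contMDiffAt_subtype_iff.mpr (hproj.contDiffAt (isOpen_flowDom.mem_nhds q.2)).contMDiffAt
  have h2 := h1.codRestrict_sphere (n := n) fun q => by
    rw [mem_sphere_zero_iff_norm, norm_smul, norm_inv, norm_norm, inv_mul_cancel₀ (hne _ q.2)]
  have h3 : ContMDiff 𝓘(ℝ, Space n × ℝ) 𝓘(ℝ, ℝ) ∞ (fun q : U => (q : Space n × ℝ).2) := fun q =>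
    contMDiffAt_subtype_iff.mpr contDiffAt_snd.contMDiffAt
  have h4 := hK.smooth.comp_contMDiff (h2.prodMk h3) fun q =>
    ⟨Set.mem_univ _, Set.Ioo_subset_Ico_self q.2.2⟩
  intro q hq
  have h5 : ContMDiffAt 𝓘(ℝ, Space n × ℝ) 𝓘(ℝ, ℝ) ∞
      (fun q : Space n × ℝ => supportFn (K q.2) (‖q.1‖⁻¹ • q.1)) q :=
    contMDiffAt_subtype_iff (x := (⟨q, hq⟩ : U)).mp (h4 ⟨q, hq⟩)
  have h6 := (hnorm q hq).mul h5.contDiffAt.contDiffWithinAt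
  exact h6.congr (fun y hy => supportFn_eq_norm_mul _ hy.1) (supportFn_eq_norm_mul _ hq.1)

theorem contDiffOn_slice {f : Space n × ℝ → ℝ} (hf : ContDiffOn ℝ ∞ f (flowDom n T)) {t : ℝ}
    (ht : t ∈ Set.Ioo 0 T) : ContDiffOn ℝ ∞ (fun x => f (x, t)) {0}ᶜ :=
  hf.comp (contDiff_id.prodMk contDiff_const).contDiffOn fun _ hx => ⟨hx, ht⟩

theorem dirDeriv_dirDeriv_slice {f : Space n × ℝ → ℝ} (hf : ContDiffOn ℝ ∞ f (flowDom n T))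
    {t : ℝ} (ht : t ∈ Set.Ioo 0 T) {x : Space n} (hx : x ≠ 0) (v w : Space n) :
    dirDeriv (dirDeriv (fun x => f (x, t)) v) w x =
      dirDeriv (dirDeriv f (v, 0)) (w, 0) (x, t) := by
  have h1 : Set.EqOn (dirDeriv (fun x => f (x, t)) v) (fun x => dirDeriv f (v, 0) (x, t)) {0}ᶜ :=
    fun y hy => dirDeriv_slice (differentiableAt_of_contDiffOn hf isOpen_flowDom ⟨hy, ht⟩) v
  rw [dirDeriv_congr isOpen_compl_singleton hx h1]
  exact dirDeriv_slice (differentiableAt_of_contDiffOn (contDiffOn_dirDeriv hf isOpen_flowDom _)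
    isOpen_flowDom ⟨hx, ht⟩) w

/-- The matrix of the spatial second derivatives of `f` at `(z, t)` in an orthonormal basis of the
tangent space of the sphere. -/
noncomputable def hessMat (f : Space n × ℝ → ℝ) (z : Space n) (t : ℝ) :
    Matrix (Fin (Module.finrank ℝ (tangentSpaceAt z)))
      (Fin (Module.finrank ℝ (tangentSpaceAt z))) ℝ :=
  Matrix.of fun i j => dirDeriv (dirDeriv f (stdOrthonormalBasis ℝ (tangentSpaceAt z) j, 0))
    (stdOrthonormalBasis ℝ (tangentSpaceAt z) i, 0) (z, t)

theorem inner_tangent {z : Space n} (v : tangentSpaceAt z) : inner ℝ z (v : Space n) = 0 :=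
  Submodule.mem_orthogonal_singleton_iff_inner_right.mp v.2

theorem finrank_tangentSpaceAt {z : Space n} (hz : z ≠ 0) :
    Module.finrank ℝ (tangentSpaceAt z) = n := by
  have : Fact (Module.finrank ℝ (Space n) = n + 1) := ⟨finrank_euclideanSpace_fin⟩
  exact Submodule.finrank_orthogonal_span_singleton hz

section HessMat

variable {f g : Space n × ℝ → ℝ} {z : Space n} {t : ℝ}

theorem hessMat_transpose (hf : ContDiffOn ℝ ∞ f (flowDom n T)) (hz : (z, t) ∈ flowDom n T) :
    (hessMat f z t).transpose = hessMat f z t := by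
  ext i j
  exact dirDeriv_comm hf isOpen_flowDom hz _ _

theorem dotProduct_hessMat_mulVec (hf : ContDiffOn ℝ ∞ f (flowDom n T))
    (hz : (z, t) ∈ flowDom n T) (v : Fin (Module.finrank ℝ (tangentSpaceAt z)) → ℝ) :
    v ⬝ᵥ (hessMat f z t).mulVec v =
      dirDeriv (dirDeriv f
        (((∑ i, v i • stdOrthonormalBasis ℝ (tangentSpaceAt z) i : tangentSpaceAt z)
          : Space n), 0))
        (((∑ i, v i • stdOrthonormalBasis ℝ (tangentSpaceAt z) i : tangentSpaceAt z)
          : Space n), 0) (z, t) := by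
  have h : (((∑ i, v i • stdOrthonormalBasis ℝ (tangentSpaceAt z) i : tangentSpaceAt z)
      : Space n), (0 : ℝ)) = ∑ i, v i •
        ((stdOrthonormalBasis ℝ (tangentSpaceAt z) i : Space n), (0 : ℝ)) := by
    ext1
    · simp [Prod.fst_sum]
    · simp [Prod.snd_sum]
  rw [h, dirDeriv_dirDeriv hf isOpen_flowDom hz]
  simp only [map_sum, map_smul, sum_apply, smul_apply, smul_eq_mul, dotProduct, Matrix.mulVec,
    hessMat, Matrix.of_apply, dirDeriv_dirDeriv hf isOpen_flowDom hz, Finset.mul_sum]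
  rw [Finset.sum_comm]
  refine Finset.sum_congr rfl fun i _ => Finset.sum_congr rfl fun j _ => ?_
  ring

/-- The orthonormal basis depends on `z` but not on time, so only commutation of partial derivatives
is needed. -/
theorem hasDerivAt_hessMat (hf : ContDiffOn ℝ ∞ f (flowDom n T)) (hz : (z, t) ∈ flowDom n T)
    (i j : Fin (Module.finrank ℝ (tangentSpaceAt z))) :
    HasDerivAt (fun τ => hessMat f z τ i j) (hessMat (dirDeriv f (0, 1)) z t i j) t := by
  have hO := isOpen_flowDom (n := n) (T := T)
  set v : Space n × ℝ := (stdOrthonormalBasis ℝ (tangentSpaceAt z) j, 0)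
  set w : Space n × ℝ := (stdOrthonormalBasis ℝ (tangentSpaceAt z) i, 0)
  have h1 := contDiffOn_dirDeriv hf hO v
  have h2 := hasDerivAt_time
    (differentiableAt_of_contDiffOn (contDiffOn_dirDeriv h1 hO w) hO hz)
  rw [dirDeriv_comm h1 hO hz,
    dirDeriv_congr hO hz (fun q hq => dirDeriv_comm hf hO hq v (0, 1))] at h2
  exact h2

/-- The cross terms of the product rule drop out at a spatial critical point of `f`; the application
is to `Q V` at a minimum of `Q`. -/
theorem hessMat_mul (hf : ContDiffOn ℝ ∞ f (flowDom n T)) (hg : ContDiffOn ℝ ∞ g (flowDom n T))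
    (hz : (z, t) ∈ flowDom n T) (h0 : ∀ v : Space n, dirDeriv f (v, 0) (z, t) = 0) :
    hessMat (fun q => f q * g q) z t =
      f (z, t) • hessMat g z t + g (z, t) • hessMat f z t := by
  ext i j
  simp only [hessMat, Matrix.of_apply, Matrix.add_apply, Matrix.smul_apply, smul_eq_mul,
    dirDeriv_dirDeriv_mul hf hg isOpen_flowDom hz, h0]
  ring

theorem hessMat_congr (h : Set.EqOn f g (flowDom n T)) (hz : (z, t) ∈ flowDom n T) :
    hessMat f z t = hessMat g z t := by
  ext i j
  exact dirDeriv_congr isOpen_flowDom hz (fun q hq => dirDeriv_congr isOpen_flowDom hq h _) _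

theorem detRadii_eq_det_hessMat (hK : IsPFlow p T K) (hz : ‖z‖ = 1) (ht : t ∈ Set.Ioo 0 T) :
    detRadii (K t) z = (hessMat (flowSupp K) z t).det := by
  have hz0 : z ≠ 0 := by rintro rfl; simp at hz
  have hf := contDiffOn_flowSupp hK
  rw [detRadii]
  congr 1
  ext i j
  rw [Matrix.of_apply, radiiForm_eq (contDiffOn_slice hf ht) hz (inner_tangent _)
    (inner_tangent _)]
  exact dirDeriv_dirDeriv_slice hf ht hz0 _ _

theorem posDef_hessMat (hK : IsPFlow p T K) (hz : ‖z‖ = 1) (ht : t ∈ Set.Ioo 0 T) :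
    (hessMat (flowSupp K) z t).PosDef := by
  have hz0 : z ≠ 0 := by rintro rfl; simp at hz
  have hf := contDiffOn_flowSupp hK
  have hzt : (z, t) ∈ flowDom n T := ⟨hz0, ht⟩
  refine Matrix.PosDef.of_dotProduct_mulVec_pos ?_ fun v hv => ?_
  · exact (Matrix.conjTranspose_eq_transpose_of_trivial _).trans (hessMat_transpose hf hzt)
  rw [star_trivial, dotProduct_hessMat_mulVec hf hzt, ← dirDeriv_dirDeriv_slice hf ht hz0]
  refine radii_pos (hK.body t (Set.Ioo_subset_Ico_self ht)).1 (contDiffOn_slice hf ht) hz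
    (inner_tangent _) ?_
  rw [Ne, Submodule.coe_eq_zero]
  intro h
  refine hv (funext fun i => ?_)
  exact Fintype.linearIndependent_iff.mp
    (stdOrthonormalBasis ℝ (tangentSpaceAt z)).orthonormal.linearIndependent v h i

end HessMat

end CentroAffine

/-! ### The logarithmic derivative of the speed and its evolution. -/

namespace CentroAffine

/-- The time derivative of the support function. -/
noncomputable def flowVel {n : ℕ} (K : ℝ → ConvexBody (Space n)) : Space n × ℝ → ℝ :=
  dirDeriv (flowSupp K) (0, 1)

/-- The logarithmic time derivative of the speed. -/
noncomputable def logSpeedDeriv {n : ℕ} (K : ℝ → ConvexBody (Space n)) (q : Space n × ℝ) : ℝ :=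
  dirDeriv (flowVel K) (0, 1) q / flowVel K q

variable {n : ℕ} {p T : ℝ} {K : ℝ → ConvexBody (Space n)} {x z : Space n} {t : ℝ}

theorem hasDerivAt_smul_time {f : Space n × ℝ → ℝ} (hf : ContDiffOn ℝ ∞ f (flowDom n T)) {c : ℝ}
    (hc : 0 < c) (hx : x ≠ 0) (hhom : ∀ τ ∈ Set.Ioo 0 T, f (c • x, τ) = c * f (x, τ))
    (ht : t ∈ Set.Ioo 0 T) :
    dirDeriv f (0, 1) (c • x, t) = c * dirDeriv f (0, 1) (x, t) := by
  have h1 := hasDerivAt_time (x := c • x) (t := t)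
    (differentiableAt_of_contDiffOn hf isOpen_flowDom ⟨smul_ne_zero hc.ne' hx, ht⟩)
  have h2 := (hasDerivAt_time (x := x) (t := t)
    (differentiableAt_of_contDiffOn hf isOpen_flowDom ⟨hx, ht⟩)).const_mul c
  refine h1.unique (h2.congr_of_eventuallyEq ?_)
  filter_upwards [isOpen_Ioo.mem_nhds ht] with τ hτ using hhom τ hτ

theorem contDiffOn_flowVel (hK : IsPFlow p T K) : ContDiffOn ℝ ∞ (flowVel K) (flowDom n T) :=
  contDiffOn_dirDeriv (contDiffOn_flowSupp hK) isOpen_flowDom _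

theorem flowVel_smul (hK : IsPFlow p T K) {c : ℝ} (hc : 0 < c) (hx : x ≠ 0)
    (ht : t ∈ Set.Ioo 0 T) : flowVel K (c • x, t) = c * flowVel K (x, t) :=
  hasDerivAt_smul_time (contDiffOn_flowSupp hK) hc hx
    (fun τ _ => supportFn_smul (K τ) hc.le x) ht

/-- A quotient of two functions of degree one. Degree zero turns a minimum over the sphere into a
local minimum in `ℝⁿ⁺¹`. -/
theorem logSpeedDeriv_smul (hK : IsPFlow p T K) {c : ℝ} (hc : 0 < c) (hx : x ≠ 0)
    (ht : t ∈ Set.Ioo 0 T) : logSpeedDeriv K (c • x, t) = logSpeedDeriv K (x, t) := by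
  rw [logSpeedDeriv, logSpeedDeriv, flowVel_smul hK hc hx ht,
    hasDerivAt_smul_time (contDiffOn_flowVel hK) hc hx
      (fun τ hτ => flowVel_smul hK hc hx hτ) ht, mul_div_mul_left _ _ hc.ne']

theorem flowVel_eq_neg_speed (hK : IsPFlow p T K) (hz : ‖z‖ = 1) (ht : t ∈ Set.Ioo 0 T) :
    flowVel K (z, t) = -speed p (K t) z := by
  have hz0 : z ≠ 0 := by rintro rfl; simp at hz
  have h1 := (hK.evolution t (Set.Ioo_subset_Ico_self ht) ⟨z, by simpa using hz⟩).hasDerivAt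
    (Ico_mem_nhds ht.1 ht.2)
  exact (hasDerivAt_time (differentiableAt_of_contDiffOn (contDiffOn_flowSupp hK) isOpen_flowDom
    ⟨hz0, ht⟩)).unique h1

theorem flowSupp_pos (hK : IsPFlow p T K) (hx : x ≠ 0) (ht : t ∈ Set.Ioo 0 T) :
    0 < flowSupp K (x, t) :=
  supportFn_pos (hK.body t (Set.Ioo_subset_Ico_self ht)) hx

theorem speed_eq (hK : IsPFlow p T K) (hz : ‖z‖ = 1) (ht : t ∈ Set.Ioo 0 T) :
    speed p (K t) z = flowSupp K (z, t) *
      ((hessMat (flowSupp K) z t).det⁻¹ / flowSupp K (z, t) ^ (n + 2)) ^ (p / (p + n + 1)) := by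
  rw [speed, gaussCurvature, detRadii_eq_det_hessMat hK hz ht]
  rfl

theorem speed_pos (hK : IsPFlow p T K) (hz : ‖z‖ = 1) (ht : t ∈ Set.Ioo 0 T) :
    0 < speed p (K t) z := by
  have hz0 : z ≠ 0 := by rintro rfl; simp at hz
  rw [speed_eq hK hz ht]
  have h1 := flowSupp_pos hK hz0 ht
  have h2 := (posDef_hessMat hK hz ht).det_pos
  positivity

theorem flowVel_neg (hK : IsPFlow p T K) (hx : x ≠ 0) (ht : t ∈ Set.Ioo 0 T) :
    flowVel K (x, t) < 0 := by
  have hn : 0 < ‖x‖ := norm_pos_iff.mpr hx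
  have h1 : ‖‖x‖⁻¹ • x‖ = 1 := by
    rw [norm_smul, norm_inv, norm_norm, inv_mul_cancel₀ hn.ne']
  have h2 := flowVel_eq_neg_speed hK h1 ht
  rw [flowVel_smul hK (inv_pos.mpr hn) hx ht] at h2
  have h3 := speed_pos hK h1 ht
  by_contra! h4
  have : 0 ≤ ‖x‖⁻¹ * flowVel K (x, t) := by positivity
  linarith

theorem contDiffOn_logSpeedDeriv (hK : IsPFlow p T K) :
    ContDiffOn ℝ ∞ (logSpeedDeriv K) (flowDom n T) :=
  (contDiffOn_dirDeriv (contDiffOn_flowVel hK) isOpen_flowDom _).div (contDiffOn_flowVel hK)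
    fun _ hq => (flowVel_neg hK hq.1 hq.2).ne

/-- `Real.log` ignores signs, so the left side is the logarithm of the speed although `flowVel` is
negative. -/
theorem log_speed_eq (hK : IsPFlow p T K) (hz : ‖z‖ = 1) (ht : t ∈ Set.Ioo 0 T) :
    Real.log (flowVel K (z, t)) =
      (1 - (n + 2) * (p / (p + n + 1))) * Real.log (flowSupp K (z, t)) -
        p / (p + n + 1) * Real.log (hessMat (flowSupp K) z t).det := by
  have hz0 : z ≠ 0 := by rintro rfl; simp at hz
  have h1 := flowSupp_pos hK hz0 ht
  have h2 := (posDef_hessMat hK hz ht).det_pos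
  rw [flowVel_eq_neg_speed hK hz ht, Real.log_neg_eq_log, speed_eq hK hz ht,
    Real.log_mul h1.ne' (by positivity), Real.log_rpow (by positivity),
    Real.log_div (by positivity) (by positivity), Real.log_inv, Real.log_pow]
  push_cast
  ring

theorem hasDerivAt_hessMat_flowSupp (hK : IsPFlow p T K) (hz : ‖z‖ = 1) (ht : t ∈ Set.Ioo 0 T)
    (i j : Fin (Module.finrank ℝ (tangentSpaceAt z))) :
    HasDerivAt (fun τ => hessMat (flowSupp K) z τ i j) (hessMat (flowVel K) z t i j) t :=
  hasDerivAt_hessMat (contDiffOn_flowSupp hK) ⟨by rintro rfl; simp at hz, ht⟩ i j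

theorem logSpeedDeriv_eq (hK : IsPFlow p T K) (hz : ‖z‖ = 1) (ht : t ∈ Set.Ioo 0 T) :
    logSpeedDeriv K (z, t) =
      (1 - (n + 2) * (p / (p + n + 1))) * (flowVel K (z, t) / flowSupp K (z, t)) -
        p / (p + n + 1) *
          ((hessMat (flowSupp K) z t)⁻¹ * hessMat (flowVel K) z t).trace := by
  have hz0 : z ≠ 0 := by rintro rfl; simp at hz
  have hzt : (z, t) ∈ flowDom n T := ⟨hz0, ht⟩
  have h1 := (hasDerivAt_time (differentiableAt_of_contDiffOn (contDiffOn_flowVel hK)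
    isOpen_flowDom hzt)).log (flowVel_neg hK hz0 ht).ne
  have h2 := (hasDerivAt_time (differentiableAt_of_contDiffOn (contDiffOn_flowSupp hK)
    isOpen_flowDom hzt)).log (flowSupp_pos hK hz0 ht).ne'
  have h3 := hasDerivAt_log_det (hasDerivAt_hessMat_flowSupp hK hz ht)
    (posDef_hessMat hK hz ht).det_pos.ne'
  refine h1.unique (((h2.const_mul _).sub (h3.const_mul _)).congr_of_eventuallyEq ?_)
  filter_upwards [isOpen_Ioo.mem_nhds ht] with τ hτ using log_speed_eq hK hz hτ

/-- Substituting `a S = β h - Q` turns the lower bound for `Q'` into at least `Q² - β h² + (β h -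
Q)² / (n a)`. Since `β ≤ 0` and `β h`, `-Q` are both non-negative, this is at least `(1 + 1 / (n a))
Q²`. -/
theorem harnack_algebra {n p β Q Q' h S S2 : ℝ} (hn : 1 ≤ n) (hp : 1 < p)
    (hβ : β = 1 - (n + 2) * (p / (p + n + 1))) (hQ : Q = β * h - p / (p + n + 1) * S)
    (hS : S ^ 2 ≤ n * S2) (hh : h < 0) (hQ0 : Q < 0)
    (hQ' : β * (Q * h - h ^ 2) + p / (p + n + 1) * S2 - p / (p + n + 1) * (Q * S) ≤ Q') :
    Q ^ 2 ≤ n * p / ((p + 1) * (n + 1)) * Q' := by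
  set a := p / (p + n + 1) with ha
  have ha0 : 0 < a := by positivity
  have hβ0 : β ≤ 0 := by
    have : β = -((n + 1) * (p - 1) / (p + n + 1)) := by
      rw [hβ, ha]; field_simp; ring
    rw [this, neg_nonpos]
    have : 0 < p - 1 := by linarith
    positivity
  -- This is the origin of the Harnack exponent.
  have hc : n * p / ((p + 1) * (n + 1)) * (1 + 1 / (n * a)) = 1 := by
    rw [ha]; field_simp; ring
  have hc0 : 0 ≤ n * p / ((p + 1) * (n + 1)) := by positivity
  have h1 : a * S = β * h - Q := by linarith
  have h2 : (β * h - Q) ^ 2 / (n * a) ≤ a * S2 := by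
    rw [← h1, div_le_iff₀ (by positivity)]
    nlinarith [mul_le_mul_of_nonneg_left hS (sq_nonneg a)]
  have h3 : (1 + 1 / (n * a)) * Q ^ 2 ≤ Q' := by
    have e1 : a * (Q * S) = Q * (β * h - Q) := by rw [← h1]; ring
    have e2 : (β * h - Q) ^ 2 / (n * a) =
        1 / (n * a) * Q ^ 2 + 1 / (n * a) * ((β * h) ^ 2 + 2 * (β * h) * (-Q)) := by ring
    have e3 : 0 ≤ β * h := mul_nonneg_of_nonpos_of_nonpos hβ0 hh.le
    have e4 : 0 ≤ 1 / (n * a) * ((β * h) ^ 2 + 2 * (β * h) * (-Q)) := by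
      have : 0 ≤ -Q := by linarith
      positivity
    have e5 : β * h ^ 2 ≤ 0 := mul_nonpos_of_nonpos_of_nonneg hβ0 (sq_nonneg h)
    rw [e1] at hQ'
    linarith
  calc Q ^ 2 = n * p / ((p + 1) * (n + 1)) * ((1 + 1 / (n * a)) * Q ^ 2) := by
        rw [← mul_assoc, hc, one_mul]
    _ ≤ _ := mul_le_mul_of_nonneg_left h3 hc0

/-- The evolution inequality at a negative spatial minimum. -/
theorem sq_le_of_isLocalMin (hK : IsPFlow p T K) (hn : 1 ≤ n) (hp : 1 < p) (hz : ‖z‖ = 1)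
    (ht : t ∈ Set.Ioo 0 T) (hmin : IsLocalMin (fun x => logSpeedDeriv K (x, t)) z)
    (hneg : logSpeedDeriv K (z, t) < 0) :
    logSpeedDeriv K (z, t) ^ 2 ≤
      n * p / ((p + 1) * (n + 1)) * dirDeriv (logSpeedDeriv K) (0, 1) (z, t) := by
  have hz0 : z ≠ 0 := by rintro rfl; simp at hz
  have hzt : (z, t) ∈ flowDom n T := ⟨hz0, ht⟩
  have hO := isOpen_flowDom (n := n) (T := T)
  have hH := contDiffOn_flowSupp hK
  have hV := contDiffOn_flowVel hK
  have hQ := contDiffOn_logSpeedDeriv hK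
  have hVneg := flowVel_neg hK hz0 ht
  have hHpos := flowSupp_pos hK hz0 ht
  have hpos := posDef_hessMat hK hz ht
  have hline : ∀ v : Space n, dirDeriv (logSpeedDeriv K) (v, 0) (z, t) = 0 ∧
      0 ≤ dirDeriv (dirDeriv (logSpeedDeriv K) (v, 0)) (v, 0) (z, t) := by
    intro v
    refine dirDeriv_of_isLocalMin_line hQ hO hzt ?_
    have hc : Filter.Tendsto (fun τ : ℝ => z + τ • v) (nhds 0) (nhds z) := by
      have : Continuous (fun τ : ℝ => z + τ • v) := by fun_prop
      simpa using this.tendsto 0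
    filter_upwards [hc.eventually hmin] with τ hτ
    simpa using hτ
  have hprod : Set.EqOn (dirDeriv (flowVel K) (0, 1))
      (fun q => logSpeedDeriv K q * flowVel K q) (flowDom n T) := fun q hq =>
    (div_mul_cancel₀ _ (flowVel_neg hK hq.1 hq.2).ne).symm
  have hhess : hessMat (dirDeriv (flowVel K) (0, 1)) z t =
      logSpeedDeriv K (z, t) • hessMat (flowVel K) z t +
        flowVel K (z, t) • hessMat (logSpeedDeriv K) z t := by
    rw [hessMat_congr hprod hzt, hessMat_mul hQ hV hzt fun v => (hline v).1]
  have htr : 0 ≤ ((hessMat (flowSupp K) z t)⁻¹ * hessMat (logSpeedDeriv K) z t).trace :=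
    hpos.trace_inv_mul_nonneg fun v => by
      rw [dotProduct_hessMat_mulVec hQ hzt]
      exact (hline _).2
  have hS := hpos.sq_trace_inv_mul_le (hessMat_transpose hV hzt)
  have hcard : (Fintype.card (Fin (Module.finrank ℝ (tangentSpaceAt z))) : ℝ) = n := by
    rw [Fintype.card_fin, finrank_tangentSpaceAt hz0]
  rw [hcard] at hS
  have d1 := hasDerivAt_time (differentiableAt_of_contDiffOn hH hO hzt)
  have d2 := hasDerivAt_time (differentiableAt_of_contDiffOn hV hO hzt)
  have d3 := hasDerivAt_trace_inv_mul (hasDerivAt_hessMat_flowSupp hK hz ht)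
    (hasDerivAt_hessMat hV hzt) hpos.det_pos.ne'
  have d4 := ((d2.div d1 hHpos.ne').const_mul (1 - (n + 2) * (p / (p + n + 1)))).sub
    (d3.const_mul (p / (p + n + 1)))
  have d5 := (hasDerivAt_time (differentiableAt_of_contDiffOn hQ hO hzt)).unique
    (d4.congr_of_eventuallyEq (by
      filter_upwards [isOpen_Ioo.mem_nhds ht] with τ hτ using logSpeedDeriv_eq hK hz hτ))
  refine harnack_algebra (h := flowVel K (z, t) / flowSupp K (z, t)) (by exact_mod_cast hn) hp rfl
    (logSpeedDeriv_eq hK hz ht) hS (div_neg_of_neg_of_pos hVneg hHpos) hneg ?_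
  rw [d5, hhess, hprod hzt, Matrix.mul_add, Matrix.trace_add, Matrix.mul_smul, Matrix.mul_smul,
    Matrix.trace_smul, Matrix.trace_smul, smul_eq_mul, smul_eq_mul]
  change _ ≤ _ * ((_ * flowSupp K (z, t) - flowVel K (z, t) * flowVel K (z, t)) / _) - _
  have ha : 0 < p / (p + n + 1) := by positivity
  have e1 : (logSpeedDeriv K (z, t) * flowVel K (z, t) * flowSupp K (z, t) -
      flowVel K (z, t) * flowVel K (z, t)) / flowSupp K (z, t) ^ 2 =
      logSpeedDeriv K (z, t) * (flowVel K (z, t) / flowSupp K (z, t)) -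
        (flowVel K (z, t) / flowSupp K (z, t)) ^ 2 := by
    field_simp
  rw [e1]
  -- The one term involving the Hessian of `Q`; it can be discarded because `V < 0` at a point where
  -- that Hessian is semidefinite.
  have e2 : p / (p + n + 1) * (flowVel K (z, t) *
      ((hessMat (flowSupp K) z t)⁻¹ * hessMat (logSpeedDeriv K) z t).trace) ≤ 0 :=
    mul_nonpos_of_nonneg_of_nonpos ha.le (mul_nonpos_of_nonpos_of_nonneg hVneg.le htr)
  linarith

end CentroAffine

/-! ### The maximum principle. -/

namespace CentroAffine

variable {n : ℕ} {p T : ℝ} {K : ℝ → ConvexBody (Space n)} {z : Space n} {t : ℝ}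

/-- The maximum principle, started at a positive time `ε`. -/
theorem neg_le_mul_logSpeedDeriv_of_lt (hK : IsPFlow p T K) (hn : 1 ≤ n) (hp : 1 < p)
    (hz : ‖z‖ = 1) {ε : ℝ} (hε : 0 < ε) (hεt : ε < t) (htT : t < T) :
    0 ≤ (t - ε) * logSpeedDeriv K (z, t) + n * p / ((p + 1) * (n + 1)) := by
  set c : ℝ := n * p / ((p + 1) * (n + 1)) with hc
  have hn0 : (0 : ℝ) < n := by exact_mod_cast hn
  have hc0 : 0 < c := by positivity
  have hO := isOpen_flowDom (n := n) (T := T)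
  have hQ := contDiffOn_logSpeedDeriv hK
  let W : Space n × ℝ → ℝ := fun q => (q.2 - ε) * logSpeedDeriv K q + c
  let S : Set (Space n × ℝ) := Metric.sphere 0 1 ×ˢ Set.Icc ε t
  have hSΩ : S ⊆ flowDom n T := fun q hq =>
    ⟨ne_zero_of_mem_unit_sphere ⟨q.1, hq.1⟩, hε.trans_le hq.2.1, hq.2.2.trans_lt htT⟩
  have hW : ContinuousOn W S := by
    have := (hQ.continuousOn).mono hSΩ
    fun_prop
  have hcomp : IsCompact S := (isCompact_sphere _ _).prod isCompact_Icc
  have hzt : (z, t) ∈ S := ⟨by simpa using hz, hεt.le, le_rfl⟩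
  obtain ⟨⟨z₀, t₀⟩, hq₀, hmin⟩ := hcomp.exists_isMinOn ⟨_, hzt⟩ hW
  have hle : W (z₀, t₀) ≤ W (z, t) := hmin hzt
  refine le_trans ?_ hle
  by_contra! hneg
  have hz₀ : ‖z₀‖ = 1 := by simpa using hq₀.1
  have hz₀0 : z₀ ≠ 0 := by rintro rfl; simp at hz₀
  have hΩ := hSΩ hq₀
  have hWdef : W (z₀, t₀) = (t₀ - ε) * logSpeedDeriv K (z₀, t₀) + c := rfl
  -- At time `ε` the function `W` equals `c > 0`, so no initial bound on `Q` is required.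
  have hεt₀ : 0 < t₀ - ε := by
    refine lt_of_le_of_ne (sub_nonneg.mpr hq₀.2.1) fun h => ?_
    rw [hWdef, ← h] at hneg
    linarith
  have hQneg : logSpeedDeriv K (z₀, t₀) < 0 := by
    by_contra! h
    have := mul_nonneg hεt₀.le h
    linarith
  have hspace : IsLocalMin (fun x => logSpeedDeriv K (x, t₀)) z₀ := by
    filter_upwards [isOpen_ne.mem_nhds hz₀0] with x hx
    have hx0 : 0 < ‖x‖ := norm_pos_iff.mpr hx
    rw [← logSpeedDeriv_smul hK (inv_pos.mpr hx0) hx hΩ.2]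
    have hxS : (‖x‖⁻¹ • x, t₀) ∈ S :=
      ⟨by rw [mem_sphere_zero_iff_norm, norm_smul, norm_inv, norm_norm,
        inv_mul_cancel₀ hx0.ne'], hq₀.2⟩
    have h : W (z₀, t₀) ≤ W (‖x‖⁻¹ • x, t₀) := hmin hxS
    exact le_of_mul_le_mul_left (le_of_add_le_add_right h) hεt₀
  have hmain := sq_le_of_isLocalMin hK hn hp hz₀ hΩ.2 hspace hQneg
  rw [← hc] at hmain
  have hd := hasDerivAt_time (differentiableAt_of_contDiffOn hQ hO hΩ)
  have hWd := (((hasDerivAt_id t₀).sub_const ε).mul hd).add_const c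
  -- Only slopes from the left are used, since `t₀` may be the final time `t`.
  have hder : logSpeedDeriv K (z₀, t₀) +
      (t₀ - ε) * dirDeriv (logSpeedDeriv K) (0, 1) (z₀, t₀) ≤ 0 := by
    have hWd' : HasDerivWithinAt (fun τ => W (z₀, τ)) (1 * logSpeedDeriv K (z₀, t₀) +
      (t₀ - ε) * dirDeriv (logSpeedDeriv K) (0, 1) (z₀, t₀)) (Set.Iio t₀) t₀ :=
      hWd.hasDerivWithinAt
    rw [one_mul] at hWd'
    refine le_of_tendsto (hasDerivWithinAt_iff_tendsto_slope' (by simp) |>.mp hWd') ?_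
    have hev : ∀ᶠ τ in nhdsWithin t₀ (Set.Iio t₀), ε < τ :=
      nhdsWithin_le_nhds (lt_mem_nhds (sub_pos.mp hεt₀))
    filter_upwards [hev, self_mem_nhdsWithin] with τ h1 h2
    have h2' : τ < t₀ := h2
    have h3 : W (z₀, t₀) ≤ W (z₀, τ) :=
      hmin (show (z₀, τ) ∈ S from ⟨hq₀.1, h1.le, h2'.le.trans hq₀.2.2⟩)
    rw [slope_def_field]
    exact div_nonpos_of_nonneg_of_nonpos (by linarith) (by linarith)
  -- `Q W = (t₀ - ε) Q² + c Q ≤ c ((t₀ - ε) ∂ₜQ + Q) ≤ 0`, whereas `Q` and `W` are both negative.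
  have h1 : logSpeedDeriv K (z₀, t₀) * W (z₀, t₀) ≤ 0 := by
    have e1 : c * (logSpeedDeriv K (z₀, t₀) +
        (t₀ - ε) * dirDeriv (logSpeedDeriv K) (0, 1) (z₀, t₀)) ≤ 0 :=
      mul_nonpos_of_nonneg_of_nonpos hc0.le hder
    have e2 := mul_le_mul_of_nonneg_left hmain hεt₀.le
    rw [hWdef]
    linarith
  exact absurd h1 (not_le.mpr (mul_pos_of_neg_of_neg hQneg hneg))

theorem neg_le_mul_logSpeedDeriv (hK : IsPFlow p T K) (hn : 1 ≤ n) (hp : 1 < p)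
    (hz : ‖z‖ = 1) (ht : t ∈ Set.Ioo 0 T) :
    0 ≤ t * logSpeedDeriv K (z, t) + n * p / ((p + 1) * (n + 1)) := by
  have hlim : Filter.Tendsto
      (fun ε : ℝ => (t - ε) * logSpeedDeriv K (z, t) + n * p / ((p + 1) * (n + 1)))
      (nhdsWithin 0 (Set.Ioi 0))
      (nhds ((t - 0) * logSpeedDeriv K (z, t) + n * p / ((p + 1) * (n + 1)))) := by
    refine Filter.Tendsto.mono_left (Continuous.tendsto ?_ 0) nhdsWithin_le_nhds
    fun_prop
  rw [sub_zero] at hlim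
  refine ge_of_tendsto hlim ?_
  filter_upwards [self_mem_nhdsWithin, nhdsWithin_le_nhds (gt_mem_nhds ht.1)] with ε h1 h2
  exact neg_le_mul_logSpeedDeriv_of_lt hK hn hp hz h1 h2 ht.2

/-- The Harnack estimate for the time derivative of the speed. -/
theorem exists_hasDerivAt_speed (hK : IsPFlow p T K) (hn : 1 ≤ n) (hp : 1 < p)
    (hz : ‖z‖ = 1) (ht : t ∈ Set.Ioo 0 T) :
    ∃ d, HasDerivAt (fun τ => speed p (K τ) z) d t ∧
      0 ≤ t * d + n * p / ((p + 1) * (n + 1)) * speed p (K t) z := by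
  have hz0 : z ≠ 0 := by rintro rfl; simp at hz
  have hd := (hasDerivAt_time (differentiableAt_of_contDiffOn (contDiffOn_flowVel hK)
    isOpen_flowDom ⟨hz0, ht⟩)).neg
  refine ⟨_, hd.congr_of_eventuallyEq ?_, ?_⟩
  · filter_upwards [isOpen_Ioo.mem_nhds ht] with τ hτ
    rw [Pi.neg_apply, flowVel_eq_neg_speed hK hz hτ, neg_neg]
  have h1 : dirDeriv (flowVel K) (0, 1) (z, t) = logSpeedDeriv K (z, t) * -speed p (K t) z := by
    rw [← flowVel_eq_neg_speed hK hz ht]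
    exact (div_mul_cancel₀ _ (flowVel_neg hK hz0 ht).ne).symm
  rw [h1]
  have h2 := mul_nonneg (neg_le_mul_logSpeedDeriv hK hn hp hz ht) (speed_pos hK hz ht).le
  linarith

end CentroAffine

/-! ### From the differential inequality to monotonicity. -/

theorem mainTheorem2 (n : ℕ) (hn : 1 ≤ n) (p : ℝ) (hp : 1 < p) (T : ℝ)
    (K : ℝ → ConvexBody (CentroAffine.Space n)) (hK : CentroAffine.IsPFlow p T K)
    (z : CentroAffine.Sph n) :
    MonotoneOn
      (fun t => CentroAffine.speed p (K t) z * t ^ ((n * p) / ((p + 1) * (n + 1)) : ℝ))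
      (Set.Ico 0 T) ∧
    ∀ t ∈ Set.Ioo 0 T,
      (DifferentiableAt ℝ
          (fun τ => CentroAffine.speed p (K τ) z * τ ^ ((n * p) / ((p + 1) * (n + 1)) : ℝ)) t ∧
        0 ≤ deriv
          (fun τ => CentroAffine.speed p (K τ) z * τ ^ ((n * p) / ((p + 1) * (n + 1)) : ℝ)) t) ∧
      (DifferentiableAt ℝ (fun τ => CentroAffine.speed p (K τ) z) t ∧
        -((n * p) / ((p + 1) * (n + 1) * t)) * CentroAffine.speed p (K t) z ≤
          deriv (fun τ => CentroAffine.speed p (K τ) z) t) := by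

  have hz : ‖(z : CentroAffine.Space n)‖ = 1 := norm_eq_of_mem_sphere z
  have hn0 : (0 : ℝ) < n := by exact_mod_cast hn
  set c : ℝ := (n * p) / ((p + 1) * (n + 1)) with hc
  have hc0 : 0 < c := by positivity
  have key : ∀ t ∈ Set.Ioo 0 T, ∃ d d' : ℝ,
      HasDerivAt (fun τ => CentroAffine.speed p (K τ) z) d t ∧
      0 ≤ t * d + c * CentroAffine.speed p (K t) z ∧
      HasDerivAt (fun τ => CentroAffine.speed p (K τ) z * τ ^ c) d' t ∧ 0 ≤ d' := by
    intro t ht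
    obtain ⟨d, h1, h2⟩ := CentroAffine.exists_hasDerivAt_speed hK hn hp hz ht
    refine ⟨d, _, h1, h2, h1.mul (Real.hasDerivAt_rpow_const (Or.inl ht.1.ne')), ?_⟩
    have h3 : t ^ c = t * t ^ (c - 1) := by
      rw [Real.rpow_sub_one ht.1.ne', mul_div_cancel₀ _ ht.1.ne']
    have h4 : d * t ^ c + CentroAffine.speed p (K t) z * (c * t ^ (c - 1)) =
        (t * d + c * CentroAffine.speed p (K t) z) * t ^ (c - 1) := by
      rw [h3]; ring
    rw [h4]
    exact mul_nonneg h2 (Real.rpow_nonneg ht.1.le _)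
  refine ⟨?_, fun t ht => ?_⟩
  · have hmono : MonotoneOn (fun t => CentroAffine.speed p (K t) z * t ^ c) (Set.Ioo 0 T) := by
      refine monotoneOn_of_deriv_nonneg (convex_Ioo 0 T) (fun t ht => ?_) (fun t ht => ?_)
        fun t ht => ?_
      · obtain ⟨d, d', -, -, h, -⟩ := key t ht
        exact h.continuousAt.continuousWithinAt
      · obtain ⟨d, d', -, -, h, -⟩ := key t (interior_subset ht)
        exact h.differentiableAt.differentiableWithinAt
      · obtain ⟨d, d', -, -, h, h'⟩ := key t (interior_subset ht)
        rwa [h.deriv]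
    intro a ha b hb hab
    -- Time `0` is outside the differential argument; there the function is `0` because `0 ^ c = 0`
    -- for `c > 0`, and it is non-negative afterwards.
    rcases ha.1.eq_or_lt with rfl | ha0
    · rcases hb.1.eq_or_lt with rfl | hb0
      · exact le_rfl
      · simp only [Real.zero_rpow hc0.ne', mul_zero]
        exact mul_nonneg (CentroAffine.speed_pos hK hz ⟨hb0, hb.2⟩).le
          (Real.rpow_nonneg hb.1 _)
    · exact hmono ⟨ha0, ha.2⟩ ⟨ha0.trans_le hab, hb.2⟩ hab
  · obtain ⟨d, d', h1, h2, h3, h4⟩ := key t ht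
    refine ⟨⟨h3.differentiableAt, by rwa [h3.deriv]⟩, h1.differentiableAt, ?_⟩
    rw [h1.deriv, ← div_div, ← hc, neg_mul, div_mul_eq_mul_div, neg_le_iff_add_nonneg,
      ← mul_le_mul_iff_right₀ ht.1]
    have : t * (d + c * CentroAffine.speed p (K t) z / t) =
        t * d + c * CentroAffine.speed p (K t) z := by
      have := ht.1.ne'
      field_simp
    rw [mul_zero, this]
    exact h2
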